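/- Let $X=(x_1,\dots,x_n)$, $n\ge 1$, be a finite family of points in $\mathbb{R}^d$. For a finite nonempty set $C\subset\mathbb{R}^d$ put $\phi_x(C)=\min_{c\in C}\|x-c\|^2$ and $\phi_X(C)=\sum_{i=1}^n\phi_{x_i}(C)$; let $\mu_X=\frac1n\sum_i x_i$ be the mean, and for $k\ge 1$ let $\phi^*=\inf_{|C|=k}\phi_X(C)$ be the optimal $k$-means cost. Assume $\phi^*>0$ and put $\gamma=\phi_X(\{\mu_X\})/\phi^*$. The $k$-means$||$ overseeding algorithm with sampling factor $\ell$ and $t$ rounds starts with $C=\{x\}$, where $x$ is a uniformly random point of $X$, and then performs $t$ rounds. In each round, every point $x$ of $X$ is put into a set $C'$ with probability $\min\left(1,\frac{\ell\,\phi_x(C)}{\phi_X(C)}\right)$, independently of the other points (no point is added if $\phi_X(C)=0$), and then $C$ is replaced by $C\cup C'$. After $t$ rounds the set $C$ is returned. Theorem. There are absolute constants $A,B,c>0$ such that for all $d$, $n\ge1$, $k\ge 1$ and $X$ as above with $\phi^*>0$, and for every number of rounds $$t\;\ge\; B\cdot\min\left(k,\ \frac{\log\hat\gamma}{\log\log\hat\gamma}\right),\qquad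 \hat\gamma=\max(\gamma,e^e),$$ the set $C$ returned by the overseeding algorithm with $\ell=k$ and $t$ rounds satisfies $$\Pr\left[\phi_X(C)\le A\,\phi^*\right]\;\ge\;1-\exp\left(-c\,k^{0.1}\right).$$ In particular $t=O\left(\min\left(k,\frac{\log\gamma}{\log\log\gamma}\right)\right)$ sampling rounds suffice for a constant-factor approximation with probability $1-\exp(-\Omega(k^{0.1}))$. -/

import Mathlib

open scoped ENNReal

noncomputable section

namespace KMeansPar

/-- The cost `φ_X(C) = ∑_{x ∈ X} d(x, C)²` of the finite family of data points `X` in `ℝ^d` with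
respect to a set `C` of centers.  (For finite nonempty `C` the number `Metric.infDist x C` is the
minimum of the distances from `x` to the points of `C`; `C` is never empty below.) -/
def cost {d n : ℕ} (X : Fin n → EuclideanSpace ℝ (Fin d))
    (C : Set (EuclideanSpace ℝ (Fin d))) : ℝ :=
  ∑ i, Metric.infDist (X i) C ^ 2

/-- The optimal cost `φ*`: the infimum of `φ_X(C)` over all sets `C ⊆ ℝ^d` of exactly `k`
centers. -/
def optCost {d n : ℕ} (X : Fin n → EuclideanSpace ℝ (Fin d)) (k : ℕ) : ℝ :=
  sInf {r : ℝ | ∃ C : Finset (EuclideanSpace ℝ (Fin d)), C.card = k ∧ r = cost X (C : Set _)}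

/-- The mean `μ_X` of the data. -/
def mean {d n : ℕ} (X : Fin n → EuclideanSpace ℝ (Fin d)) : EuclideanSpace ℝ (Fin d) :=
  (n : ℝ)⁻¹ • ∑ i, X i

/-- `γ = φ_X(μ_X) / φ*`. -/
def gam {d n : ℕ} (X : Fin n → EuclideanSpace ℝ (Fin d)) (k : ℕ) : ℝ :=
  cost X {mean X} / optCost X k

/-- `log γ / log log γ` for `γ ≥ e^e`.  For smaller `γ`, where `log log γ` may vanish, be negative
or be undefined, the value `e` at `γ = e^e` is used; it is the minimum of the expression
over all `γ > e`. -/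
def logRatio (γ : ℝ) : ℝ :=
  Real.log (max γ (Real.exp (Real.exp 1))) / Real.log (Real.log (max γ (Real.exp (Real.exp 1))))

/-- The set of points of `ℝ^d` that have been chosen when the data points with indices in `S`
have been chosen. -/
def centers {d n : ℕ} (X : Fin n → EuclideanSpace ℝ (Fin d)) (S : Finset (Fin n)) :
    Set (EuclideanSpace ℝ (Fin d)) :=
  X '' (S : Set (Fin n))

/-- The probability `min(1, ℓ φ_x(C) / φ_X(C))` with which the data point `x = X i` is sampled in
one round, the current centers `C` being the data points with indices in `S`.  (If `φ_X(C) = 0`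
this is `0`: nothing is sampled any more.) -/
def sampleProb {d n : ℕ} (X : Fin n → EuclideanSpace ℝ (Fin d)) (l : ℝ) (S : Finset (Fin n))
    (i : Fin n) : ℝ≥0∞ :=
  ENNReal.ofReal (min 1 (l * Metric.infDist (X i) (centers X S) ^ 2 / cost X (centers X S)))

theorem sampleProb_le_one {d n : ℕ} (X : Fin n → EuclideanSpace ℝ (Fin d)) (l : ℝ)
    (S : Finset (Fin n)) (i : Fin n) : sampleProb X l S i ≤ 1 :=
  ENNReal.ofReal_le_one.2 (min_le_left _ _)

/-- The law of the random set `R` that contains each index `i` with probability `p i`,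
independently of the other indices. -/
def indepSubset {n : ℕ} (p : Fin n → ℝ≥0∞) (hp : ∀ i, p i ≤ 1) : PMF (Finset (Fin n)) :=
  PMF.ofFintype (fun R => (∏ i ∈ R, p i) * ∏ i ∈ Rᶜ, (1 - p i)) (by
    have h := Finset.prod_add p (fun i => 1 - p i) Finset.univ
    rw [Finset.powerset_univ] at h
    simp only [Finset.compl_eq_univ_sdiff]
    rw [← h]
    exact Finset.prod_eq_one fun i _ => add_tsub_cancel_of_le (hp i))

/-- One sampling round: `C ← C ∪ C'`, where `C'` contains each data point independently with its
sampling probability with respect to `C`. -/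
def samplingRound {d n : ℕ} (X : Fin n → EuclideanSpace ℝ (Fin d)) (l : ℝ) (S : Finset (Fin n)) :
    PMF (Finset (Fin n)) :=
  (indepSubset (sampleProb X l S) (sampleProb_le_one X l S)).map (fun R => S ∪ R)

/-- The law of the output of `k`-means`||` overseeding with sampling factor `l` after `t` sampling
rounds, as a random set of indices of data points: the first center is uniform, and then `t`
sampling rounds are performed. -/
def overseeding {d n : ℕ} [NeZero n] (X : Fin n → EuclideanSpace ℝ (Fin d)) (l : ℝ) :
    ℕ → PMF (Finset (Fin n))
  | 0 => (PMF.uniformOfFintype (Fin n)).map (fun i => {i})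
  | t + 1 => (overseeding X l t).bind (samplingRound X l)

end KMeansPar

end

/-!
Fix `k` reference centers whose cost is at most `2 φ*`, and the clusters they induce. A cluster is
*unsettled* while its cost exceeds `40` times its cost with respect to its reference center. As long
as `φ_X(C) > 160 φ*`, the unsettled clusters carry at least half of the total cost.

One chosen point in the core of a cluster (the points near the reference center) settles it
(`clusterCost_le_of_mem_core`), and the core of an unsettled cluster carries a constant fraction of
its cost (`clusterCost_le_sum_core`). Hence in a round an unsettled cluster `j` stays unsettled with
probability at most `exp (-w j / 16)`, where `w j` is `k` times its share of the total cost
(`prod_core_le_exp`), and different cores are missed independently (`sum_weight_prod`).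

The bound by `k` rounds: the shares of the unsettled clusters sum to at least `1 / 2`, so a round
settles none of them with probability at most `exp (-k / 32)`
(`unsettled_card_lt_samplingRound`). After `k` successful rounds none is left.

The bound by `log γ / log log γ` rounds: the first round reduces the cost to `O(γ φ*)`
(`cost_le_of_first_round`). Let `L` be a small power of `log γ`, times a constant. The clusters with
`w j ≥ L` that survive a round carry, up to an exponentially small probability, only a `1 / (8 L)`
fraction of the cost; this follows from the exponential moment of their total share
(`sum_weight_heavy_le`). So if the round does not reduce the cost by the factor `L`, then the
remaining cost is spread over at least `k / (4 L²)` unsettled clusters, none of them much cheaper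
than the average (`crowded_of_slow`), and the following round settles a `1 / poly(L)` fraction of
all `k` clusters (`unsettled_card_drop_of_crowded`). There are at most `log γ / log L` rounds of the
first kind and at most `poly(L)`, which is `O(log γ / log log γ)`, of the second kind.
The function `rank` expresses this count by the current state alone, so that the failure
probabilities of the single rounds can simply be multiplied up (`mul_pow_le_overseeding`). They are
exponentially small in `√k`, since `L³ = O(√k)` when `log γ / log log γ ≤ k`; this leaves room for
the product over `O(k)` rounds. For `k` below an absolute constant only a positive success
probability is needed, which the bound by `k` rounds provides.
-/

/-! ### Clusters, cores and their costs -/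

namespace KMeansPar

variable {d n : ℕ} {ι : Type*} [DecidableEq ι]

/-- The cost `φ_A(C)` of the cluster `A = a⁻¹(j)`, where the centers `C` are the data points with
indices in `S`. -/
noncomputable def clusterCost (X : Fin n → EuclideanSpace ℝ (Fin d)) (a : Fin n → ι)
    (S : Finset (Fin n)) (j : ι) : ℝ :=
  ∑ i with a i = j, Metric.infDist (X i) (centers X S) ^ 2

/-- The cost of the cluster `a⁻¹(j)` with respect to its own reference center `z j`. -/
noncomputable def centerCost (X : Fin n → EuclideanSpace ℝ (Fin d)) (a : Fin n → ι)
    (z : ι → EuclideanSpace ℝ (Fin d)) (j : ι) : ℝ :=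
  ∑ i with a i = j, dist (X i) (z j) ^ 2

/-- The core of a cluster: its members whose squared distance from the reference center is at most
four times the average. -/
noncomputable def core (X : Fin n → EuclideanSpace ℝ (Fin d)) (a : Fin n → ι)
    (z : ι → EuclideanSpace ℝ (Fin d)) (j : ι) : Finset (Fin n) :=
  {i | a i = j ∧
    (Finset.card {i' | a i' = j} : ℝ) * dist (X i) (z j) ^ 2 ≤ 4 * centerCost X a z j}

theorem clusterCost_nonneg (X : Fin n → EuclideanSpace ℝ (Fin d)) (a : Fin n → ι)
    (S : Finset (Fin n)) (j : ι) : 0 ≤ clusterCost X a S j :=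
  Finset.sum_nonneg fun _ _ => sq_nonneg _

theorem centerCost_nonneg (X : Fin n → EuclideanSpace ℝ (Fin d)) (a : Fin n → ι)
    (z : ι → EuclideanSpace ℝ (Fin d)) (j : ι) : 0 ≤ centerCost X a z j :=
  Finset.sum_nonneg fun _ _ => sq_nonneg _

theorem cost_nonneg (X : Fin n → EuclideanSpace ℝ (Fin d))
    (C : Set (EuclideanSpace ℝ (Fin d))) : 0 ≤ cost X C :=
  Finset.sum_nonneg fun _ _ => sq_nonneg _

theorem sum_clusterCost [Fintype ι] (X : Fin n → EuclideanSpace ℝ (Fin d)) (a : Fin n → ι)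
    (S : Finset (Fin n)) : ∑ j, clusterCost X a S j = cost X (centers X S) := by
  unfold clusterCost cost
  exact Finset.sum_fiberwise _ _ _

theorem sum_centerCost [Fintype ι] (X : Fin n → EuclideanSpace ℝ (Fin d)) (a : Fin n → ι)
    (z : ι → EuclideanSpace ℝ (Fin d)) :
    ∑ j, centerCost X a z j = ∑ i, dist (X i) (z (a i)) ^ 2 := by
  unfold centerCost
  rw [← Finset.sum_fiberwise (g := a)]
  refine Finset.sum_congr rfl fun j _ => Finset.sum_congr rfl fun i hi => ?_
  rw [(Finset.mem_filter.1 hi).2]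

theorem infDist_centers_anti (X : Fin n → EuclideanSpace ℝ (Fin d)) {S S' : Finset (Fin n)}
    (hS : S.Nonempty) (h : S ⊆ S') (x : EuclideanSpace ℝ (Fin d)) :
    Metric.infDist x (centers X S') ≤ Metric.infDist x (centers X S) :=
  Metric.infDist_le_infDist_of_subset (Set.image_mono (by exact_mod_cast h))
    ((Finset.coe_nonempty.2 hS).image X)

theorem clusterCost_anti (X : Fin n → EuclideanSpace ℝ (Fin d)) (a : Fin n → ι)
    {S S' : Finset (Fin n)} (hS : S.Nonempty) (h : S ⊆ S') (j : ι) :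
    clusterCost X a S' j ≤ clusterCost X a S j :=
  Finset.sum_le_sum fun _ _ =>
    pow_le_pow_left₀ Metric.infDist_nonneg (infDist_centers_anti X hS h _) 2

theorem cost_centers_anti (X : Fin n → EuclideanSpace ℝ (Fin d)) {S S' : Finset (Fin n)}
    (hS : S.Nonempty) (h : S ⊆ S') : cost X (centers X S') ≤ cost X (centers X S) :=
  Finset.sum_le_sum fun _ _ =>
    pow_le_pow_left₀ Metric.infDist_nonneg (infDist_centers_anti X hS h _) 2

/-- A single center from the core of a cluster is already a good center for the whole cluster. -/
theorem clusterCost_le_of_mem_core (X : Fin n → EuclideanSpace ℝ (Fin d)) (a : Fin n → ι)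
    (z : ι → EuclideanSpace ℝ (Fin d)) {S : Finset (Fin n)} {j : ι} {i : Fin n}
    (hi : i ∈ core X a z j) (hS : i ∈ S) :
    clusterCost X a S j ≤ 10 * centerCost X a z j := by
  have hi' := (Finset.mem_filter.1 hi).2.2
  calc clusterCost X a S j
      ≤ ∑ i' with a i' = j, (2 * dist (X i') (z j) ^ 2 + 2 * dist (X i) (z j) ^ 2) := by
        refine Finset.sum_le_sum fun i' _ => ?_
        have h1 : Metric.infDist (X i') (centers X S) ≤ dist (X i') (X i) :=
          Metric.infDist_le_dist_of_mem (Set.mem_image_of_mem X (by exact_mod_cast hS))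
        have h2 := dist_triangle_right (X i') (X i) (z j)
        have h3 : 0 ≤ Metric.infDist (X i') (centers X S) := Metric.infDist_nonneg
        nlinarith [sq_nonneg (dist (X i') (z j) - dist (X i) (z j))]
    _ = 2 * centerCost X a z j
        + 2 * ((Finset.card {i' | a i' = j} : ℝ) * dist (X i) (z j) ^ 2) := by
        rw [Finset.sum_add_distrib, ← Finset.mul_sum, Finset.sum_const, nsmul_eq_mul]
        unfold centerCost
        ring
    _ ≤ _ := by linarith

/-- By Markov's inequality the core contains at least three quarters of its cluster. -/
theorem three_mul_card_le_card_core (X : Fin n → EuclideanSpace ℝ (Fin d)) (a : Fin n → ι)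
    (z : ι → EuclideanSpace ℝ (Fin d)) (j : ι) :
    3 * (Finset.card {i | a i = j} : ℝ) ≤ 4 * (core X a z j).card := by
  set P : Finset (Fin n) := {i | a i = j} with hP
  set c := centerCost X a z j with hc
  have hsub : core X a z j ⊆ P := fun i hi => by
    have := (Finset.mem_filter.1 hi).2.1
    simp [hP, this]
  have hcard : ((P \ core X a z j).card : ℝ) = P.card - (core X a z j).card := by
    rw [Finset.card_sdiff_of_subset hsub, Nat.cast_sub (Finset.card_le_card hsub)]
  have hout : ∀ i ∈ P \ core X a z j, 4 * c < P.card * dist (X i) (z j) ^ 2 := by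
    intro i hi
    obtain ⟨h1, h2⟩ := Finset.mem_sdiff.1 hi
    by_contra h
    exact h2 (Finset.mem_filter.2 ⟨Finset.mem_univ _, (Finset.mem_filter.1 h1).2, not_lt.1 h⟩)
  have hle : ∑ i ∈ P \ core X a z j, dist (X i) (z j) ^ 2 ≤ c :=
    Finset.sum_le_sum_of_subset_of_nonneg Finset.sdiff_subset fun _ _ _ => sq_nonneg _
  have h1 : ((P \ core X a z j).card : ℝ) * (4 * c) ≤ P.card * c := by
    calc ((P \ core X a z j).card : ℝ) * (4 * c)
        = ∑ i ∈ P \ core X a z j, 4 * c := by rw [Finset.sum_const, nsmul_eq_mul]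
      _ ≤ ∑ i ∈ P \ core X a z j, (P.card : ℝ) * dist (X i) (z j) ^ 2 :=
        Finset.sum_le_sum fun i hi => (hout i hi).le
      _ ≤ _ := by
        rw [← Finset.mul_sum]
        exact mul_le_mul_of_nonneg_left hle (Nat.cast_nonneg _)
  rcases (centerCost_nonneg X a z j).eq_or_lt with h0 | h0
  · -- if the cluster coincides with its reference center, then so does its core
    have hempty : P \ core X a z j = ∅ := by
      refine Finset.eq_empty_of_forall_notMem fun i hi => ?_
      have h2 := hout i hi
      have h3 := Finset.single_le_sum (f := fun i => dist (X i) (z j) ^ 2)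
        (fun _ _ => sq_nonneg _) hi
      have h4 : dist (X i) (z j) ^ 2 ≤ 0 := by
        have h5 : dist (X i) (z j) ^ 2 ≤ c := h3.trans hle
        linarith
      have h5 := mul_nonpos_of_nonneg_of_nonpos (Nat.cast_nonneg (α := ℝ) P.card) h4
      linarith
    rw [hempty] at hcard
    have : (0 : ℝ) ≤ P.card := Nat.cast_nonneg _
    simp only [Finset.card_empty, Nat.cast_zero] at hcard
    linarith
  · have h2 : ((P \ core X a z j).card : ℝ) * 4 ≤ P.card :=
      le_of_mul_le_mul_right (by linarith) h0
    linarith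

/-- In a badly covered cluster the core carries a constant fraction of the cost: the core is close
to the reference center, and the reference center is far from all chosen centers. -/
theorem clusterCost_le_sum_core (X : Fin n → EuclideanSpace ℝ (Fin d)) (a : Fin n → ι)
    (z : ι → EuclideanSpace ℝ (Fin d)) {S : Finset (Fin n)} {j : ι}
    (h : 40 * centerCost X a z j < clusterCost X a S j) :
    clusterCost X a S j ≤ 16 * ∑ i ∈ core X a z j, Metric.infDist (X i) (centers X S) ^ 2 := by
  have h34 := three_mul_card_le_card_core X a z j
  set N : ℝ := (Finset.card {i | a i = j} : ℝ) with hN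
  set c := centerCost X a z j with hc
  set Φ := clusterCost X a S j with hΦ
  set D := Metric.infDist (z j) (centers X S) with hD
  have hc0 : 0 ≤ c := centerCost_nonneg X a z j
  have hD0 : 0 ≤ D := Metric.infDist_nonneg
  have hupper : Φ ≤ 2 * c + 2 * (N * D ^ 2) := by
    calc Φ ≤ ∑ i with a i = j, (2 * dist (X i) (z j) ^ 2 + 2 * D ^ 2) := by
          refine Finset.sum_le_sum fun i _ => ?_
          have h1 : Metric.infDist (X i) (centers X S) ≤ D + dist (X i) (z j) :=
            Metric.infDist_le_infDist_add_dist
          have h2 : 0 ≤ Metric.infDist (X i) (centers X S) := Metric.infDist_nonneg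
          nlinarith [sq_nonneg (D - dist (X i) (z j))]
      _ = _ := by
          rw [Finset.sum_add_distrib, ← Finset.mul_sum, Finset.sum_const, nsmul_eq_mul, hc, hN]
          unfold centerCost
          ring
  have hN0 : 0 < N := by
    have h1 : 0 < N * D ^ 2 := by linarith
    exact pos_of_mul_pos_left h1 (sq_nonneg D)
  have hcore : ∀ i ∈ core X a z j, Φ / 8 ≤ N * Metric.infDist (X i) (centers X S) ^ 2 := by
    intro i hi
    have hi' : N * dist (X i) (z j) ^ 2 ≤ 4 * c := (Finset.mem_filter.1 hi).2.2
    have h1 : D ≤ Metric.infDist (X i) (centers X S) + dist (X i) (z j) := by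
      rw [dist_comm]
      exact Metric.infDist_le_infDist_add_dist
    have h2 : D ^ 2 ≤ 2 * Metric.infDist (X i) (centers X S) ^ 2 + 2 * dist (X i) (z j) ^ 2 := by
      nlinarith [sq_nonneg (Metric.infDist (X i) (centers X S) - dist (X i) (z j))]
    have h3 := mul_le_mul_of_nonneg_left h2 hN0.le
    linarith
  have hsum : ((core X a z j).card : ℝ) * (Φ / 8)
      ≤ N * ∑ i ∈ core X a z j, Metric.infDist (X i) (centers X S) ^ 2 := by
    rw [Finset.mul_sum, ← nsmul_eq_mul, ← Finset.sum_const]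
    exact Finset.sum_le_sum hcore
  refine le_of_mul_le_mul_left ?_ hN0
  have hΦ0 : 0 ≤ Φ := clusterCost_nonneg X a S j
  have := mul_le_mul_of_nonneg_right h34 hΦ0
  linarith [mul_nonneg hN0.le hΦ0]

end KMeansPar

/-! ### One sampling round -/

namespace KMeansPar

variable {d n : ℕ} {ι : Type*}

/-- The probability that a random subset of `Fin n`, containing each `i` independently with
probability `p i`, equals `R`. -/
noncomputable def weight (p : Fin n → ℝ) (R : Finset (Fin n)) : ℝ :=
  (∏ i ∈ R, p i) * ∏ i ∈ Rᶜ, (1 - p i)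

theorem weight_nonneg {p : Fin n → ℝ} (h0 : ∀ i, 0 ≤ p i) (h1 : ∀ i, p i ≤ 1)
    (R : Finset (Fin n)) : 0 ≤ weight p R :=
  mul_nonneg (Finset.prod_nonneg fun i _ => h0 i)
    (Finset.prod_nonneg fun i _ => sub_nonneg.2 (h1 i))

/-- The probability that the random subset avoids `G`. -/
theorem sum_weight_disjoint (p : Fin n → ℝ) (G : Finset (Fin n)) :
    ∑ R, weight p R * (if Disjoint R G then 1 else 0) = ∏ i ∈ G, (1 - p i) := by
  -- with the probabilities on `G` replaced by `0`, only the sets avoiding `G` have positive weight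
  have h := Finset.prod_add (fun i => if i ∈ G then 0 else p i) (fun i => 1 - p i) Finset.univ
  rw [Finset.powerset_univ] at h
  have hl : ∏ i, ((if i ∈ G then 0 else p i) + (1 - p i)) = ∏ i ∈ G, (1 - p i) := by
    rw [← Finset.prod_subset (Finset.subset_univ G)]
    · exact Finset.prod_congr rfl fun i hi => by simp [hi]
    · intro i _ hi
      simp [hi]
  rw [← hl, h]
  refine Finset.sum_congr rfl fun R _ => ?_
  rw [← Finset.compl_eq_univ_sdiff]
  by_cases hd : Disjoint R G
  · rw [if_pos hd, mul_one, weight]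
    congr 1
    exact Finset.prod_congr rfl fun i hi => by simp [Finset.disjoint_left.1 hd hi]
  · rw [if_neg hd, mul_zero]
    obtain ⟨i, hi, hG⟩ := Finset.not_disjoint_iff.1 hd
    rw [Finset.prod_eq_zero hi (by simp [hG]), zero_mul]

theorem sum_weight (p : Fin n → ℝ) : ∑ R, weight p R = 1 := by
  simpa using sum_weight_disjoint p ∅

/-- Independence: for disjoint sets `G j`, the events that the random subset avoids `G j` are
independent. -/
theorem sum_weight_prod [DecidableEq ι] (p : Fin n → ℝ) (J : Finset ι)
    (G : ι → Finset (Fin n)) (hG : (J : Set ι).PairwiseDisjoint G) (b : ι → ℝ) :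
    ∑ R, weight p R * ∏ j ∈ J, (1 + b j * (if Disjoint R (G j) then 1 else 0))
      = ∏ j ∈ J, (1 + b j * ∏ i ∈ G j, (1 - p i)) := by
  simp_rw [Finset.prod_one_add, Finset.mul_sum]
  rw [Finset.sum_comm]
  refine Finset.sum_congr rfl fun T hT => ?_
  have hTJ := Finset.mem_powerset.1 hT
  rw [Finset.prod_mul_distrib, ← Finset.prod_biUnion (hG.subset (by exact_mod_cast hTJ)),
    ← sum_weight_disjoint, Finset.mul_sum]
  refine Finset.sum_congr rfl fun R _ => ?_
  rw [Finset.prod_mul_distrib, Finset.prod_ite_zero]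
  simp only [Finset.prod_const_one, Finset.disjoint_biUnion_right]
  ring

/-- The moment generating function of a weighted number of avoided sets. -/
theorem sum_weight_exp [DecidableEq ι] (p : Fin n → ℝ) (J : Finset ι)
    (G : ι → Finset (Fin n)) (hG : (J : Set ι).PairwiseDisjoint G) (s : ι → ℝ) :
    ∑ R, weight p R * Real.exp (∑ j ∈ J with Disjoint R (G j), s j)
      = ∏ j ∈ J, (1 + (Real.exp (s j) - 1) * ∏ i ∈ G j, (1 - p i)) := by
  rw [← sum_weight_prod p J G hG]
  refine Finset.sum_congr rfl fun R _ => ?_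
  rw [Finset.sum_filter, Real.exp_sum]
  congr 1
  refine Finset.prod_congr rfl fun j _ => ?_
  split_ifs <;> simp

/-- The sampling probability as a real number. -/
noncomputable def sampleProbReal (X : Fin n → EuclideanSpace ℝ (Fin d)) (l : ℝ)
    (S : Finset (Fin n)) (i : Fin n) : ℝ :=
  min 1 (l * Metric.infDist (X i) (centers X S) ^ 2 / cost X (centers X S))

theorem sampleProbReal_nonneg (X : Fin n → EuclideanSpace ℝ (Fin d)) {l : ℝ} (hl : 0 ≤ l)
    (S : Finset (Fin n)) (i : Fin n) : 0 ≤ sampleProbReal X l S i :=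
  le_min zero_le_one (div_nonneg (mul_nonneg hl (sq_nonneg _)) (cost_nonneg _ _))

theorem sampleProbReal_le_one (X : Fin n → EuclideanSpace ℝ (Fin d)) (l : ℝ)
    (S : Finset (Fin n)) (i : Fin n) : sampleProbReal X l S i ≤ 1 :=
  min_le_left _ _

theorem indepSubset_apply (X : Fin n → EuclideanSpace ℝ (Fin d)) {l : ℝ} (hl : 0 ≤ l)
    (S R : Finset (Fin n)) :
    indepSubset (sampleProb X l S) (sampleProb_le_one X l S) R
      = ENNReal.ofReal (weight (sampleProbReal X l S) R) := by
  have h0 := sampleProbReal_nonneg X hl S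
  have h1 := sampleProbReal_le_one X l S
  rw [weight, ENNReal.ofReal_mul (Finset.prod_nonneg fun i _ => h0 i),
    ENNReal.ofReal_prod_of_nonneg (fun i _ => h0 i),
    ENNReal.ofReal_prod_of_nonneg (fun i _ => sub_nonneg.2 (h1 i))]
  simp_rw [ENNReal.ofReal_sub 1 (h0 _), ENNReal.ofReal_one]
  rfl

/-- A Markov-type bound for one sampling round: the failure probability is at most the expectation
of any nonnegative function that is at least `1` on failure. -/
theorem one_sub_le_samplingRound (X : Fin n → EuclideanSpace ℝ (Fin d)) {l : ℝ} (hl : 0 ≤ l)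
    (S : Finset (Fin n)) (s : Set (Finset (Fin n))) (f : Finset (Fin n) → ℝ)
    (hf : ∀ R, 0 ≤ f R) (hfs : ∀ R, S ∪ R ∉ s → 1 ≤ f R) {ε : ℝ}
    (hε : ∑ R, weight (sampleProbReal X l S) R * f R ≤ ε) :
    ENNReal.ofReal (1 - ε) ≤ (samplingRound X l S).toOuterMeasure s := by
  classical
  have hw := weight_nonneg (sampleProbReal_nonneg X hl S) (sampleProbReal_le_one X l S)
  rw [samplingRound, PMF.toOuterMeasure_map_apply, PMF.toOuterMeasure_apply_fintype]
  have h1 : ∀ R, Set.indicator ((fun R => S ∪ R) ⁻¹' s)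
      (indepSubset (sampleProb X l S) (sampleProb_le_one X l S)) R
      = ENNReal.ofReal (if S ∪ R ∈ s then weight (sampleProbReal X l S) R else 0) := by
    intro R
    rw [Set.indicator_apply]
    by_cases h : S ∪ R ∈ s
    · rw [if_pos (show R ∈ (fun R => S ∪ R) ⁻¹' s from h), if_pos h, indepSubset_apply X hl]
    · rw [if_neg (show R ∉ (fun R => S ∪ R) ⁻¹' s from h), if_neg h, ENNReal.ofReal_zero]
  simp_rw [h1]
  rw [← ENNReal.ofReal_sum_of_nonneg (fun R _ => by split_ifs; exacts [hw R, le_rfl])]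
  refine ENNReal.ofReal_le_ofReal ?_
  rw [← sum_weight (sampleProbReal X l S), sub_le_iff_le_add]
  refine le_trans ?_ (add_le_add_right hε _)
  rw [← Finset.sum_add_distrib]
  refine Finset.sum_le_sum fun R _ => ?_
  split_ifs with h
  · exact le_add_of_nonneg_right (mul_nonneg (hw R) (hf R))
  · rw [zero_add]
    exact le_mul_of_one_le_right (hw R) (hfs R h)

/-- The core of an unsettled cluster is missed with probability exponentially small in the
expected number of sampled points of the cluster. -/
theorem prod_core_le_exp [DecidableEq ι] (X : Fin n → EuclideanSpace ℝ (Fin d)) {l : ℝ}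
    (hl : 0 ≤ l) (a : Fin n → ι) (z : ι → EuclideanSpace ℝ (Fin d)) {S : Finset (Fin n)} {j : ι}
    (h : 40 * centerCost X a z j < clusterCost X a S j) :
    ∏ i ∈ core X a z j, (1 - sampleProbReal X l S i)
      ≤ Real.exp (-(l * clusterCost X a S j / cost X (centers X S) / 16)) := by
  -- truncating the sampling probability at `1` does no harm
  have hle : ∀ x : ℝ, 1 - min 1 x ≤ Real.exp (-x) := by
    intro x
    rcases le_total 1 x with hx | hx
    · rw [min_eq_left hx, sub_self]
      exact (Real.exp_pos _).le
    · rw [min_eq_right hx]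
      linarith [Real.add_one_le_exp (-x)]
  calc ∏ i ∈ core X a z j, (1 - sampleProbReal X l S i)
      ≤ ∏ i ∈ core X a z j,
        Real.exp (-(l * Metric.infDist (X i) (centers X S) ^ 2 / cost X (centers X S))) :=
        Finset.prod_le_prod (fun i _ => sub_nonneg.2 (sampleProbReal_le_one X l S i))
          fun i _ => hle _
    _ = Real.exp (-(l / cost X (centers X S)
          * ∑ i ∈ core X a z j, Metric.infDist (X i) (centers X S) ^ 2)) := by
        rw [← Real.exp_sum, Finset.sum_neg_distrib, Finset.mul_sum]
        congr 2
        exact Finset.sum_congr rfl fun i _ => by ring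
    _ ≤ _ := by
        refine Real.exp_le_exp.2 (neg_le_neg ?_)
        have h1 := mul_le_mul_of_nonneg_left (clusterCost_le_sum_core X a z h)
          (div_nonneg hl (cost_nonneg X (centers X S)))
        calc l * clusterCost X a S j / cost X (centers X S) / 16
            = l / cost X (centers X S) * clusterCost X a S j / 16 := by ring
          _ ≤ _ := by linarith

theorem pairwiseDisjoint_core [DecidableEq ι] (X : Fin n → EuclideanSpace ℝ (Fin d))
    (a : Fin n → ι) (z : ι → EuclideanSpace ℝ (Fin d)) (s : Set ι) :
    s.PairwiseDisjoint (core X a z) := by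
  intro j _ j' _ hne
  refine Finset.disjoint_left.2 fun i hi hi' => hne ?_
  rw [← (Finset.mem_filter.1 hi).2.1, ← (Finset.mem_filter.1 hi').2.1]

/-- If every state that is good at time `t` moves with probability at least `q` to a state
that is good at time `t + 1`, then goodness is kept for `t` rounds with probability at least
`q ^ t`. -/
theorem mul_pow_le_overseeding [NeZero n] (X : Fin n → EuclideanSpace ℝ (Fin d)) (l : ℝ)
    (good : ℕ → Set (Finset (Fin n))) (q : ℝ≥0∞)
    (hstep : ∀ t, ∀ S ∈ good t, q ≤ (samplingRound X l S).toOuterMeasure (good (t + 1)))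
    (s t : ℕ) :
    (overseeding X l s).toOuterMeasure (good 0) * q ^ t
      ≤ (overseeding X l (s + t)).toOuterMeasure (good t) := by
  induction t with
  | zero => simp
  | succ t ih =>
    have hrec : overseeding X l (s + (t + 1))
        = (overseeding X l (s + t)).bind (samplingRound X l) := rfl
    rw [hrec, PMF.toOuterMeasure_bind_apply, pow_succ, ← mul_assoc]
    refine (mul_le_mul_left ih q).trans ?_
    rw [PMF.toOuterMeasure_apply, ← ENNReal.tsum_mul_right]
    refine ENNReal.tsum_le_tsum fun S => ?_
    by_cases hS : S ∈ good t
    · rw [Set.indicator_of_mem hS]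
      gcongr
      exact hstep t S hS
    · simp [Set.indicator_of_notMem hS]

end KMeansPar

/-! ### Progress of the unsettled clusters in one round -/

namespace KMeansPar

variable {d n : ℕ} {ι : Type*} [DecidableEq ι] [Fintype ι]

/-- The clusters that are badly covered by the data points with indices in `S`. -/
noncomputable def unsettled (X : Fin n → EuclideanSpace ℝ (Fin d)) (a : Fin n → ι)
    (z : ι → EuclideanSpace ℝ (Fin d)) (S : Finset (Fin n)) : Finset ι :=
  {j | 40 * centerCost X a z j < clusterCost X a S j}

theorem mem_unsettled {X : Fin n → EuclideanSpace ℝ (Fin d)} {a : Fin n → ι}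
    {z : ι → EuclideanSpace ℝ (Fin d)} {S : Finset (Fin n)} {j : ι} :
    j ∈ unsettled X a z S ↔ 40 * centerCost X a z j < clusterCost X a S j := by
  simp [unsettled]

/-- A cluster that is unsettled after a round was unsettled before, and its core was missed. -/
theorem unsettled_union_subset (X : Fin n → EuclideanSpace ℝ (Fin d)) (a : Fin n → ι)
    (z : ι → EuclideanSpace ℝ (Fin d)) {S : Finset (Fin n)} (hS : S.Nonempty)
    (R : Finset (Fin n)) :
    unsettled X a z (S ∪ R) ⊆ {j ∈ unsettled X a z S | Disjoint R (core X a z j)} := by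
  intro j hj
  rw [mem_unsettled] at hj
  rw [Finset.mem_filter, mem_unsettled]
  refine ⟨hj.trans_le (clusterCost_anti X a hS Finset.subset_union_left j), ?_⟩
  by_contra hd
  obtain ⟨i, hi, hc⟩ := Finset.not_disjoint_iff.1 hd
  have := clusterCost_le_of_mem_core X a z hc (Finset.mem_union_right S hi)
  linarith [centerCost_nonneg X a z j]

/-- As long as the total cost is large, the unsettled clusters carry half of it. -/
theorem cost_le_two_mul_sum_unsettled (X : Fin n → EuclideanSpace ℝ (Fin d)) (a : Fin n → ι)
    (z : ι → EuclideanSpace ℝ (Fin d)) {S : Finset (Fin n)}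
    (h : 80 * ∑ j, centerCost X a z j < cost X (centers X S)) :
    cost X (centers X S) ≤ 2 * ∑ j ∈ unsettled X a z S, clusterCost X a S j := by
  have h1 : cost X (centers X S) ≤ ∑ j ∈ unsettled X a z S, clusterCost X a S j
      + ∑ j, 40 * centerCost X a z j := by
    rw [← sum_clusterCost X a S, ← Finset.sum_add_sum_compl (unsettled X a z S)]
    refine add_le_add_right ?_ _
    refine le_trans (Finset.sum_le_sum fun j hj => ?_)
      (Finset.sum_le_sum_of_subset_of_nonneg (Finset.subset_univ _) fun j _ _ =>
        mul_nonneg (by norm_num) (centerCost_nonneg X a z j))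
    rw [Finset.mem_compl, mem_unsettled, not_lt] at hj
    exact hj
  rw [← Finset.mul_sum] at h1
  linarith

/-- While the cost is large, a round settles at least one new cluster with high probability. -/
theorem unsettled_card_lt_samplingRound (X : Fin n → EuclideanSpace ℝ (Fin d)) (a : Fin n → ι)
    (z : ι → EuclideanSpace ℝ (Fin d)) {l : ℝ} (hl : 0 ≤ l) {S : Finset (Fin n)}
    (hS : S.Nonempty) (h : 80 * ∑ j, centerCost X a z j < cost X (centers X S)) :
    ENNReal.ofReal (1 - Real.exp (-(l / 32))) ≤ (samplingRound X l S).toOuterMeasure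
      {S' | S ⊆ S' ∧ (unsettled X a z S').card < (unsettled X a z S).card} := by
  have hφ : 0 < cost X (centers X S) :=
    lt_of_le_of_lt (mul_nonneg (by norm_num)
      (Finset.sum_nonneg fun j _ => centerCost_nonneg X a z j)) h
  refine one_sub_le_samplingRound X hl S _
    (fun R => if Disjoint R ((unsettled X a z S).biUnion (core X a z)) then 1 else 0)
    (fun R => by split_ifs <;> norm_num) (fun R hR => ?_) ?_
  · have hR' : (unsettled X a z S).card ≤ (unsettled X a z (S ∪ R)).card := by
      by_contra hlt
      exact hR ⟨Finset.subset_union_left, not_le.1 hlt⟩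
    have hsub := unsettled_union_subset X a z hS R
    have heq := Finset.eq_of_subset_of_card_le (hsub.trans (Finset.filter_subset _ _)) hR'
    rw [heq] at hsub
    rw [if_pos]
    exact (Finset.disjoint_biUnion_right _ _ _).2 fun j hj => (Finset.mem_filter.1 (hsub hj)).2
  · rw [sum_weight_disjoint, Finset.prod_biUnion (pairwiseDisjoint_core X a z _)]
    calc ∏ j ∈ unsettled X a z S, ∏ i ∈ core X a z j, (1 - sampleProbReal X l S i)
        ≤ ∏ j ∈ unsettled X a z S,
          Real.exp (-(l * clusterCost X a S j / cost X (centers X S) / 16)) :=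
          Finset.prod_le_prod
            (fun j _ => Finset.prod_nonneg fun i _ =>
              sub_nonneg.2 (sampleProbReal_le_one X l S i))
            fun j hj => prod_core_le_exp X hl a z (mem_unsettled.1 hj)
      _ = Real.exp (-(l / 16 *
            ((∑ j ∈ unsettled X a z S, clusterCost X a S j) / cost X (centers X S)))) := by
          rw [← Real.exp_sum, Finset.sum_neg_distrib, Finset.sum_div, Finset.mul_sum]
          congr 2
          exact Finset.sum_congr rfl fun j _ => by ring
      _ ≤ _ := by
          refine Real.exp_le_exp.2 (neg_le_neg ?_)
          have h1 : 1 / 2 ≤ (∑ j ∈ unsettled X a z S, clusterCost X a S j)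
              / cost X (centers X S) := by
            rw [le_div_iff₀ hφ]
            linarith [cost_le_two_mul_sum_unsettled X a z h]
          have := mul_le_mul_of_nonneg_left h1 (div_nonneg hl (by norm_num : (0 : ℝ) ≤ 16))
          linarith

/-- The unsettled clusters whose cost is not much smaller than the average, at scale `L`. -/
noncomputable def crowd (X : Fin n → EuclideanSpace ℝ (Fin d)) (a : Fin n → ι)
    (z : ι → EuclideanSpace ℝ (Fin d)) (L : ℝ) (S : Finset (Fin n)) : Finset ι :=
  {j ∈ unsettled X a z S |
    cost X (centers X S) ≤ 8 * L * (Fintype.card ι : ℝ) * clusterCost X a S j}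

/-- A state is crowded at scale `L` if the fraction of clusters in its crowd is at least
`1 / (4 L²)`. -/
def Crowded (X : Fin n → EuclideanSpace ℝ (Fin d)) (a : Fin n → ι)
    (z : ι → EuclideanSpace ℝ (Fin d)) (L : ℝ) (S : Finset (Fin n)) : Prop :=
  (Fintype.card ι : ℝ) ≤ 4 * L ^ 2 * (crowd X a z L S).card

/-- From a crowded state, a round settles many clusters with high probability. -/
theorem unsettled_card_drop_of_crowded (X : Fin n → EuclideanSpace ℝ (Fin d)) (a : Fin n → ι)
    (z : ι → EuclideanSpace ℝ (Fin d)) {L : ℝ} (hL : 1 ≤ L) {S : Finset (Fin n)}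
    (hS : S.Nonempty) (hφ : 0 < cost X (centers X S)) (hc : Crowded X a z L S) :
    ENNReal.ofReal (1 - Real.exp (-((Fintype.card ι : ℝ) / (4096 * L ^ 3))))
      ≤ (samplingRound X (Fintype.card ι : ℝ) S).toOuterMeasure
        {S' | S ⊆ S' ∧ ((unsettled X a z S').card : ℝ) + (Fintype.card ι : ℝ) / (4096 * L ^ 3)
          ≤ (unsettled X a z S).card} := by
  set k : ℝ := (Fintype.card ι : ℝ) with hk
  have hk0 : 0 ≤ k := Nat.cast_nonneg _
  set h : ℝ := k / (4096 * L ^ 3) with hh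
  set Q := crowd X a z L S with hQ
  set V := unsettled X a z S with hV
  have hL0 : 0 < L := by linarith
  have hQV : Q ⊆ V := Finset.filter_subset _ _
  -- the exponential moment of the number of missed cores in the crowd
  refine one_sub_le_samplingRound X hk0 S _
    (fun R => Real.exp (∑ j ∈ Q with Disjoint R (core X a z j), 1) * Real.exp (h - Q.card))
    (fun R => by positivity) (fun R hR => ?_) ?_
  · -- every cluster of the crowd whose core is hit becomes settled
    have hcard : (unsettled X a z (S ∪ R)).card + Q.card
        ≤ V.card + (Finset.card {j ∈ Q | Disjoint R (core X a z j)}) := by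
      have h1 : (unsettled X a z (S ∪ R)).card ≤ Finset.card {j ∈ V | Disjoint R (core X a z j)} :=
        Finset.card_le_card (unsettled_union_subset X a z hS R)
      have h2 := Finset.card_filter_add_card_filter_not (s := V)
        (fun j => Disjoint R (core X a z j))
      have h3 := Finset.card_filter_add_card_filter_not (s := Q)
        (fun j => Disjoint R (core X a z j))
      have h4 : Finset.card {j ∈ Q | ¬ Disjoint R (core X a z j)}
          ≤ Finset.card {j ∈ V | ¬ Disjoint R (core X a z j)} :=
        Finset.card_le_card (Finset.filter_subset_filter _ hQV)
      omega
    have hlt : (V.card : ℝ) < (unsettled X a z (S ∪ R)).card + h := by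
      by_contra hle
      exact hR ⟨Finset.subset_union_left, not_lt.1 hle⟩
    have hcard' : ((unsettled X a z (S ∪ R)).card : ℝ) + Q.card
        ≤ V.card + (Finset.card {j ∈ Q | Disjoint R (core X a z j)}) := by exact_mod_cast hcard
    rw [← Real.exp_add, Finset.sum_const, nsmul_eq_mul, mul_one]
    refine Real.one_le_exp ?_
    linarith
  · simp_rw [← mul_assoc]
    rw [← Finset.sum_mul,
      sum_weight_exp _ Q _ (pairwiseDisjoint_core X a z _) (fun _ => (1 : ℝ))]
    have hfac : ∀ j ∈ Q, 1 + (Real.exp 1 - 1) *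
        ∏ i ∈ core X a z j, (1 - sampleProbReal X k S i)
        ≤ Real.exp (1 - 1 / (512 * L)) := by
      intro j hj
      have hjV := mem_unsettled.1 (hQV hj)
      have hjQ : cost X (centers X S) ≤ 8 * L * k * clusterCost X a S j :=
        (Finset.mem_filter.1 hj).2
      set q := ∏ i ∈ core X a z j, (1 - sampleProbReal X k S i) with hq
      have hw : 1 / (8 * L) ≤ k * clusterCost X a S j / cost X (centers X S) := by
        rw [div_le_div_iff₀ (by positivity) hφ]
        linarith
      have hq1 : q ≤ Real.exp (-(1 / (128 * L))) := by
        refine (prod_core_le_exp X hk0 a z hjV).trans (Real.exp_le_exp.2 (neg_le_neg ?_))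
        have h1 : 1 / (128 * L) = 1 / (8 * L) / 16 := by field_simp; ring
        rw [h1]
        linarith
      set x := 1 / (128 * L) with hx
      have hx0 : 0 ≤ x := by positivity
      have hx1 : x ≤ 1 := by
        rw [hx, div_le_one (by positivity)]
        linarith
      have hq2 : q ≤ 1 - x / 2 := by
        refine hq1.trans ?_
        have h1 := Real.add_one_le_exp x
        have h2 : Real.exp (-x) * Real.exp x = 1 := by rw [← Real.exp_add]; simp
        nlinarith [Real.exp_pos (-x)]
      have he : 2 ≤ Real.exp 1 := by linarith [Real.add_one_le_exp (1 : ℝ)]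
      have hx4 : 1 / (512 * L) = x / 4 := by rw [hx]; field_simp; ring
      have hsplit : Real.exp (1 - x / 4) = Real.exp 1 * Real.exp (-(x / 4)) := by
        rw [← Real.exp_add, sub_eq_add_neg]
      rw [hx4, hsplit]
      have h1 := Real.add_one_le_exp (-(x / 4))
      calc 1 + (Real.exp 1 - 1) * q ≤ 1 + (Real.exp 1 - 1) * (1 - x / 2) := by
            have := mul_le_mul_of_nonneg_left hq2 (by linarith : 0 ≤ Real.exp 1 - 1)
            linarith
        _ ≤ Real.exp 1 * (-(x / 4) + 1) := by nlinarith
        _ ≤ _ := mul_le_mul_of_nonneg_left h1 (Real.exp_pos 1).le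
    calc (∏ j ∈ Q, (1 + (Real.exp 1 - 1) *
          ∏ i ∈ core X a z j, (1 - sampleProbReal X k S i))) * Real.exp (h - Q.card)
        ≤ (∏ j ∈ Q, Real.exp (1 - 1 / (512 * L))) * Real.exp (h - Q.card) := by
          refine mul_le_mul_of_nonneg_right
            (Finset.prod_le_prod (fun j _ => ?_) hfac) (Real.exp_pos _).le
          have h1 : 0 ≤ ∏ i ∈ core X a z j, (1 - sampleProbReal X k S i) :=
            Finset.prod_nonneg fun i _ => sub_nonneg.2 (sampleProbReal_le_one X k S i)
          have h2 : 0 ≤ Real.exp 1 - 1 := by linarith [Real.add_one_le_exp (1 : ℝ)]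
          positivity
      _ = Real.exp (h - Q.card / (512 * L)) := by
          rw [Finset.prod_const, ← Real.exp_nat_mul, ← Real.exp_add]
          congr 1
          ring
      _ ≤ Real.exp (-h) := by
          refine Real.exp_le_exp.2 ?_
          have h1 : 2 * h ≤ Q.card / (512 * L) := by
            rw [hh, mul_div_assoc', div_le_div_iff₀ (by positivity) (by positivity)]
            have h2 : k ≤ 4 * L ^ 2 * Q.card := hc
            have h3 := mul_le_mul_of_nonneg_left h2 (by positivity : 0 ≤ 1024 * L)
            linarith
          linarith

/-- An exponential moment bound on the share of the cost carried by the heavy unsettled clusters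
that are missed in a round. The factor `1 / 32` is half the rate at which a cluster survives, so
that a heavy cluster contributes `exp (w j / 32) * exp (-w j / 16)`, which is tiny. -/
theorem sum_weight_heavy_le (X : Fin n → EuclideanSpace ℝ (Fin d)) (a : Fin n → ι)
    (z : ι → EuclideanSpace ℝ (Fin d)) {L : ℝ} (hL : 2 ^ 20 ≤ L) (S : Finset (Fin n))
    {k : ℝ} (hk : k = (Fintype.card ι : ℝ)) {w : ι → ℝ}
    (hw : ∀ j, w j = k * clusterCost X a S j / cost X (centers X S)) :
    ∑ R, weight (sampleProbReal X k S) R * (Real.exp (∑ j ∈ {j ∈ unsettled X a z S | L ≤ w j}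
        with Disjoint R (core X a z j), w j / 32) * Real.exp (-(k / (256 * L))))
      ≤ Real.exp (-(k / (512 * L))) := by
  have hk0 : 0 ≤ k := hk ▸ Nat.cast_nonneg _
  have hL0 : 0 < L := lt_of_lt_of_le (by norm_num) hL
  set H : Finset ι := {j ∈ unsettled X a z S | L ≤ w j} with hH
  simp_rw [← mul_assoc]
  rw [← Finset.sum_mul, sum_weight_exp _ H _ (pairwiseDisjoint_core X a z _)]
  have hexp : Real.exp (-(L / 32)) ≤ 1 / (512 * L) := by
    rw [Real.exp_neg, ← one_div]
    refine one_div_le_one_div_of_le (by positivity) ?_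
    have h1 := Real.quadratic_le_exp_of_nonneg (by positivity : 0 ≤ L / 32)
    nlinarith
  have hfac : ∀ j ∈ H, 1 + (Real.exp (w j / 32) - 1) *
      ∏ i ∈ core X a z j, (1 - sampleProbReal X k S i) ≤ Real.exp (1 / (512 * L)) := by
    intro j hj
    obtain ⟨hjV, hjw⟩ := Finset.mem_filter.1 hj
    have hq := prod_core_le_exp X hk0 a z (mem_unsettled.1 hjV)
    rw [← hw] at hq
    have hq0 : 0 ≤ ∏ i ∈ core X a z j, (1 - sampleProbReal X k S i) :=
      Finset.prod_nonneg fun i _ => sub_nonneg.2 (sampleProbReal_le_one X k S i)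
    set q := ∏ i ∈ core X a z j, (1 - sampleProbReal X k S i)
    have h1 : Real.exp (w j / 32) * q ≤ Real.exp (-(L / 32)) := by
      calc Real.exp (w j / 32) * q
          ≤ Real.exp (w j / 32) * Real.exp (-(w j / 16)) :=
            mul_le_mul_of_nonneg_left hq (Real.exp_pos _).le
        _ = Real.exp (-(w j / 32)) := by rw [← Real.exp_add]; congr 1; ring
        _ ≤ _ := Real.exp_le_exp.2 (by linarith)
    have h2 := Real.add_one_le_exp (1 / (512 * L))
    linarith
  calc (∏ j ∈ H, (1 + (Real.exp (w j / 32) - 1) *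
        ∏ i ∈ core X a z j, (1 - sampleProbReal X k S i))) * Real.exp (-(k / (256 * L)))
      ≤ (∏ j ∈ H, Real.exp (1 / (512 * L))) * Real.exp (-(k / (256 * L))) := by
        refine mul_le_mul_of_nonneg_right
          (Finset.prod_le_prod (fun j hj => ?_) hfac) (Real.exp_pos _).le
        have h1 : 0 ≤ ∏ i ∈ core X a z j, (1 - sampleProbReal X k S i) :=
          Finset.prod_nonneg fun i _ => sub_nonneg.2 (sampleProbReal_le_one X k S i)
        have h2 : 0 ≤ Real.exp (w j / 32) - 1 := by
          have := (Finset.mem_filter.1 hj).2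
          exact sub_nonneg.2 (Real.one_le_exp (by linarith))
        positivity
    _ = Real.exp (H.card * (1 / (512 * L)) - k / (256 * L)) := by
        rw [Finset.prod_const, ← Real.exp_nat_mul, ← Real.exp_add]
        congr 1
    _ ≤ _ := by
        refine Real.exp_le_exp.2 ?_
        have h1 : (H.card : ℝ) ≤ k := by
          rw [hk]
          exact_mod_cast Finset.card_le_univ H
        have h2 := mul_le_mul_of_nonneg_right h1 (by positivity : 0 ≤ 1 / (512 * L))
        have h3 : k / (256 * L) = 2 * (k * (1 / (512 * L))) := by field_simp; ring
        have h4 : k / (512 * L) = k * (1 / (512 * L)) := by ring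
        linarith

/-- If the missed heavy clusters carry little cost and a round does not reduce the total cost by the
factor `L`, then many clusters of moderate cost remain. -/
theorem crowded_of_slow (X : Fin n → EuclideanSpace ℝ (Fin d)) (a : Fin n → ι)
    (z : ι → EuclideanSpace ℝ (Fin d)) {L : ℝ} (hL : 1 ≤ L) {S R : Finset (Fin n)}
    (hS : S.Nonempty) {k : ℝ} (hk : k = (Fintype.card ι : ℝ)) (hk0 : 0 < k) {w : ι → ℝ}
    (hw : ∀ j, w j = k * clusterCost X a S j / cost X (centers X S))
    (hbad : 80 * ∑ j, centerCost X a z j < cost X (centers X (S ∪ R)))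
    (hslow : cost X (centers X S) < L * cost X (centers X (S ∪ R)))
    (hheavy : ∑ j ∈ {j ∈ unsettled X a z S | L ≤ w j} with Disjoint R (core X a z j), w j
      ≤ k / (8 * L)) :
    Crowded X a z L (S ∪ R) := by
  have hL0 : 0 < L := by linarith
  have hφ' : 0 < cost X (centers X (S ∪ R)) :=
    lt_of_le_of_lt (mul_nonneg (by norm_num)
      (Finset.sum_nonneg fun j _ => centerCost_nonneg X a z j)) hbad
  have hanti := cost_centers_anti X hS (Finset.subset_union_left (s₂ := R))
  have hhalf := cost_le_two_mul_sum_unsettled X a z hbad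
  set φ := cost X (centers X S) with hφdef
  set φ' := cost X (centers X (S ∪ R)) with hφ'def
  have hφ : 0 < φ := by linarith
  set Hd := {j ∈ {j ∈ unsettled X a z S | L ≤ w j} | Disjoint R (core X a z j)} with hHd
  set Q := crowd X a z L (S ∪ R) with hQ
  have hwφ : ∀ j, clusterCost X a S j = φ / k * w j := by
    intro j
    rw [hw]
    field_simp
  -- a surviving cluster is heavy, or tiny, or in the new crowd
  have hpt : ∀ j ∈ unsettled X a z (S ∪ R), clusterCost X a (S ∪ R) j
      ≤ (if j ∈ Hd then φ / k * w j else 0) + φ / (8 * L * k)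
        + (if j ∈ Q then L * φ / k else 0) := by
    intro j hj
    have hle := clusterCost_anti X a hS (Finset.subset_union_left (s₂ := R)) j
    have hj' := Finset.mem_filter.1 (unsettled_union_subset X a z hS R hj)
    have hn1 : 0 ≤ (if j ∈ Hd then φ / k * w j else 0) := by
      split_ifs
      · rw [← hwφ]
        exact clusterCost_nonneg X a S j
      · exact le_rfl
    have hn2 : 0 ≤ φ / (8 * L * k) := by positivity
    have hn3 : 0 ≤ (if j ∈ Q then L * φ / k else 0) := by split_ifs <;> positivity
    by_cases h1 : clusterCost X a (S ∪ R) j ≤ φ / (8 * L * k)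
    · linarith
    · by_cases h2 : L ≤ w j
      · have : j ∈ Hd := Finset.mem_filter.2 ⟨Finset.mem_filter.2 ⟨hj'.1, h2⟩, hj'.2⟩
        rw [if_pos this] at hn1 ⊢
        rw [hwφ] at hle
        linarith
      · have : j ∈ Q := by
          refine Finset.mem_filter.2 ⟨hj, ?_⟩
          rw [not_le, div_lt_iff₀ (by positivity)] at h1
          rw [← hk]
          linarith
        rw [if_pos this] at hn3 ⊢
        have h3 : clusterCost X a S j ≤ L * φ / k := by
          rw [hwφ]
          have := mul_le_mul_of_nonneg_left (not_le.1 h2).le (by positivity : 0 ≤ φ / k)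
          calc φ / k * w j ≤ φ / k * L := this
            _ = _ := by ring
        linarith
  have hsum : ∑ j ∈ unsettled X a z (S ∪ R), clusterCost X a (S ∪ R) j
      ≤ φ / (8 * L) + φ / (8 * L) + Q.card * (L * φ / k) := by
    calc ∑ j ∈ unsettled X a z (S ∪ R), clusterCost X a (S ∪ R) j
        ≤ ∑ j ∈ unsettled X a z (S ∪ R), ((if j ∈ Hd then φ / k * w j else 0) + φ / (8 * L * k)
          + (if j ∈ Q then L * φ / k else 0)) := Finset.sum_le_sum hpt
      _ ≤ ∑ j, ((if j ∈ Hd then φ / k * w j else 0) + φ / (8 * L * k)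
          + (if j ∈ Q then L * φ / k else 0)) := by
          refine Finset.sum_le_sum_of_subset_of_nonneg (Finset.subset_univ _) fun j _ _ => ?_
          have hn1 : 0 ≤ (if j ∈ Hd then φ / k * w j else 0) := by
            split_ifs
            · rw [← hwφ]
              exact clusterCost_nonneg X a S j
            · exact le_rfl
          have hn3 : 0 ≤ (if j ∈ Q then L * φ / k else 0) := by split_ifs <;> positivity
          positivity
      _ = φ / k * ∑ j ∈ Hd, w j + k * (φ / (8 * L * k)) + Q.card * (L * φ / k) := by
          simp only [Finset.sum_add_distrib, Finset.sum_ite_mem, Finset.univ_inter,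
            Finset.sum_const, nsmul_eq_mul, Finset.card_univ, Finset.mul_sum, ← hk]
      _ ≤ _ := by
          have h1 := mul_le_mul_of_nonneg_left hheavy (by positivity : 0 ≤ φ / k)
          have h2 : φ / k * (k / (8 * L)) = φ / (8 * L) := by field_simp
          have h3 : k * (φ / (8 * L * k)) = φ / (8 * L) := by field_simp
          linarith
  have h1 : φ / (2 * L) ≤ φ / (4 * L) + Q.card * (L * φ / k) := by
    have h2 : φ / (2 * L) ≤ φ' / 2 := by
      rw [div_le_div_iff₀ (by positivity) (by norm_num)]
      linarith
    have h3 : φ / (8 * L) + φ / (8 * L) = φ / (4 * L) := by field_simp; ring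
    linarith
  have h2 : φ / (2 * L) = φ / (4 * L) + φ / (4 * L) := by field_simp; ring
  have h3 : φ / (4 * L) ≤ Q.card * (L * φ / k) := by linarith
  have h4 : Q.card * (L * φ / k) = (Q.card * L * φ) / k := by ring
  rw [h4, div_le_div_iff₀ (by positivity) hk0] at h3
  have h5 : φ * k ≤ φ * (4 * L ^ 2 * Q.card) := by linarith
  rw [Crowded, ← hk]
  exact le_of_mul_le_mul_left h5 hφ

/-- From a state that is not crowded, a round reduces the cost by the factor `L` or makes the
state crowded, with high probability. -/
theorem fast_or_crowded (X : Fin n → EuclideanSpace ℝ (Fin d)) (a : Fin n → ι)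
    (z : ι → EuclideanSpace ℝ (Fin d)) [Nonempty ι] {L : ℝ} (hL : 2 ^ 20 ≤ L)
    {S : Finset (Fin n)} (hS : S.Nonempty) :
    ENNReal.ofReal (1 - Real.exp (-((Fintype.card ι : ℝ) / (512 * L))))
      ≤ (samplingRound X (Fintype.card ι : ℝ) S).toOuterMeasure
        {S' | S ⊆ S' ∧ (80 * ∑ j, centerCost X a z j < cost X (centers X S') →
          L * cost X (centers X S') ≤ cost X (centers X S) ∨ Crowded X a z L S')} := by
  have hL0 : 0 < L := lt_of_lt_of_le (by norm_num) hL
  have hk0 : (0 : ℝ) < Fintype.card ι := by exact_mod_cast Fintype.card_pos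
  refine one_sub_le_samplingRound X hk0.le S _ _ (fun R => by positivity) (fun R hR => ?_)
    (sum_weight_heavy_le X a z hL S rfl (fun _ => rfl))
  by_contra hlt
  refine hR ⟨Finset.subset_union_left, fun hbad => ?_⟩
  by_contra hneg
  rw [not_or, not_le] at hneg
  refine hneg.2 (crowded_of_slow X a z (le_trans (by norm_num) hL) hS rfl hk0 (fun _ => rfl)
    hbad hneg.1 ?_)
  rw [← Real.exp_add, Real.one_le_exp_iff, not_le, ← Finset.sum_div] at hlt
  have h1 : (Fintype.card ι : ℝ) / (8 * L) = 32 * ((Fintype.card ι : ℝ) / (256 * L)) := by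
    field_simp
    ring
  rw [h1]
  linarith

end KMeansPar

/-! ### Several rounds -/

namespace KMeansPar

variable {d n : ℕ}

theorem one_le_samplingRound_superset (X : Fin n → EuclideanSpace ℝ (Fin d)) {l : ℝ}
    (hl : 0 ≤ l) (S : Finset (Fin n)) :
    1 ≤ (samplingRound X l S).toOuterMeasure {S' | S ⊆ S'} := by
  have h := one_sub_le_samplingRound X hl S {S' | S ⊆ S'} (fun _ => 0) (fun _ => le_rfl)
    (fun R hR => absurd Finset.subset_union_left hR) (ε := 0) (by simp)
  simpa using h

theorem ofReal_pow_le_overseeding [NeZero n] (X : Fin n → EuclideanSpace ℝ (Fin d)) (l : ℝ)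
    (good : ℕ → Set (Finset (Fin n))) (h0 : ∀ i, {i} ∈ good 0) {ε : ℝ} (hε : ε ≤ 1)
    (hstep : ∀ t, ∀ S ∈ good t,
      ENNReal.ofReal (1 - ε) ≤ (samplingRound X l S).toOuterMeasure (good (t + 1))) (t : ℕ) :
    ENNReal.ofReal ((1 - ε) ^ t) ≤ (overseeding X l t).toOuterMeasure (good t) := by
  have h := mul_pow_le_overseeding X l good _ hstep 0 t
  have h1 : (overseeding X l 0).toOuterMeasure (good 0) = 1 := by
    rw [PMF.toOuterMeasure_apply_eq_one_iff, overseeding, PMF.support_map]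
    rintro _ ⟨i, -, rfl⟩
    exact h0 i
  rwa [h1, one_mul, zero_add, ← ENNReal.ofReal_pow (sub_nonneg.2 hε)] at h

/-- Further rounds do not increase the cost. -/
theorem overseeding_cost_le_mono [NeZero n] (X : Fin n → EuclideanSpace ℝ (Fin d)) {l : ℝ}
    (hl : 0 ≤ l) (r : ℝ) {s t : ℕ} (hst : s ≤ t) :
    (overseeding X l s).toOuterMeasure {S | S.Nonempty ∧ cost X (centers X S) ≤ r}
      ≤ (overseeding X l t).toOuterMeasure {S | cost X (centers X S) ≤ r} := by
  obtain ⟨m, rfl⟩ := Nat.exists_eq_add_of_le hst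
  have h := mul_pow_le_overseeding X l
    (fun _ => {S | S.Nonempty ∧ cost X (centers X S) ≤ r}) 1 (fun _ S hS => ?_) s m
  · rw [one_pow, mul_one] at h
    exact h.trans (MeasureTheory.measure_mono fun S hS => hS.2)
  · exact (one_le_samplingRound_superset X hl S).trans (MeasureTheory.measure_mono
      fun S' hS' => ⟨hS.1.mono hS', (cost_centers_anti X hS.1 hS').trans hS.2⟩)

/-- Since the infimum in the definition of the optimal cost need not be attained a priori, the
reference clustering is taken to be optimal up to a factor of two. -/
theorem exists_clustering {k : ℕ} (hk : 1 ≤ k) (X : Fin n → EuclideanSpace ℝ (Fin d))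
    (ho : 0 < optCost X k) : ∃ (a : Fin n → Fin k) (z : Fin k → EuclideanSpace ℝ (Fin d)),
      ∑ j, centerCost X a z j ≤ 2 * optCost X k := by
  have hne : {r : ℝ | ∃ C : Finset (EuclideanSpace ℝ (Fin d)),
      C.card = k ∧ r = cost X (C : Set _)}.Nonempty := by
    by_contra h
    rw [Set.not_nonempty_iff_eq_empty] at h
    rw [optCost, h, Real.sInf_empty] at ho
    exact lt_irrefl _ ho
  obtain ⟨_, ⟨C, hC, rfl⟩, hlt⟩ := exists_lt_of_csInf_lt hne
    (show sInf _ < 2 * optCost X k by change optCost X k < _; linarith)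
  have hCne : (C : Set (EuclideanSpace ℝ (Fin d))).Nonempty := by
    rw [Finset.coe_nonempty, ← Finset.card_pos]
    omega
  choose c hcC hc using fun i =>
    C.finite_toSet.isCompact.exists_infDist_eq_dist hCne (X i)
  refine ⟨fun i => C.equivFinOfCardEq hC ⟨c i, hcC i⟩,
    fun j => ((C.equivFinOfCardEq hC).symm j : EuclideanSpace ℝ (Fin d)), ?_⟩
  rw [sum_centerCost]
  refine le_trans (le_of_eq ?_) hlt.le
  refine Finset.sum_congr rfl fun i _ => ?_
  rw [Equiv.symm_apply_apply, hc]

/-- Settling one cluster per round, the algorithm succeeds after `k` rounds. -/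
theorem overseeding_of_rounds_ge_card [NeZero n] (X : Fin n → EuclideanSpace ℝ (Fin d)) {k : ℕ}
    (hk : 1 ≤ k) (ho : 0 < optCost X k) :
    ENNReal.ofReal ((1 - Real.exp (-((k : ℝ) / 32))) ^ k)
      ≤ (overseeding X (k : ℝ) k).toOuterMeasure
        {S | S.Nonempty ∧ cost X (centers X S) ≤ 160 * optCost X k} := by
  obtain ⟨a, z, hcc⟩ := exists_clustering hk X ho
  set o := optCost X k
  have hk0 : (0 : ℝ) ≤ k := Nat.cast_nonneg k
  have h := ofReal_pow_le_overseeding X (k : ℝ)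
    (fun t => {S | S.Nonempty ∧
      (cost X (centers X S) ≤ 160 * o ∨ (unsettled X a z S).card + t ≤ k)})
    (fun i => ⟨Finset.singleton_nonempty i, Or.inr
      ((Finset.card_le_univ (unsettled X a z {i})).trans_eq (Fintype.card_fin k))⟩)
    (ε := Real.exp (-((k : ℝ) / 32))) (Real.exp_le_one_iff.2 (by linarith))
    (fun t S ⟨hS, hgood⟩ => ?_) k
  · refine h.trans (MeasureTheory.measure_mono ?_)
    rintro S ⟨hS, hgood⟩
    refine ⟨hS, hgood.elim id fun hu => ?_⟩
    by_contra hbad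
    have h1 := cost_le_two_mul_sum_unsettled X a z (S := S) (by linarith)
    rw [Finset.card_eq_zero.1 (by omega : (unsettled X a z S).card = 0),
      Finset.sum_empty] at h1
    linarith
  · by_cases hbad : cost X (centers X S) ≤ 160 * o
    · refine le_trans ?_ ((one_le_samplingRound_superset X hk0 S).trans
        (MeasureTheory.measure_mono fun S' hS' =>
          ⟨hS.mono hS', Or.inl ((cost_centers_anti X hS hS').trans hbad)⟩))
      rw [ENNReal.ofReal_le_one]
      linarith [Real.exp_pos (-((k : ℝ) / 32))]
    · refine (unsettled_card_lt_samplingRound X a z hk0 hS (by linarith)).trans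
        (MeasureTheory.measure_mono fun S' hS' => ⟨hS.mono hS'.1, Or.inr ?_⟩)
      have h1 := hgood.resolve_left hbad
      have h2 := hS'.2
      omega

/-- The first round already brings the cost down to the order of the optimal cost for a single
center, with high probability: treat the whole data as one cluster. -/
theorem cost_le_of_first_round (X : Fin n → EuclideanSpace ℝ (Fin d)) {l : ℝ} (hl : 0 ≤ l)
    {S : Finset (Fin n)} (hS : S.Nonempty) :
    ENNReal.ofReal (1 - Real.exp (-(l / 32))) ≤ (samplingRound X l S).toOuterMeasure
      {S' | S ⊆ S' ∧ cost X (centers X S') ≤ 80 * cost X {mean X}} := by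
  have hcc : ∑ j, centerCost X (fun _ => ()) (fun _ : Unit => mean X) j = cost X {mean X} := by
    rw [sum_centerCost]
    simp [cost, Metric.infDist_singleton]
  by_cases hbad : cost X (centers X S) ≤ 80 * cost X {mean X}
  · refine le_trans ?_ ((one_le_samplingRound_superset X hl S).trans
      (MeasureTheory.measure_mono fun S' hS' => ⟨hS', (cost_centers_anti X hS hS').trans hbad⟩))
    rw [ENNReal.ofReal_le_one]
    linarith [Real.exp_pos (-(l / 32))]
  · refine (unsettled_card_lt_samplingRound X (fun _ => ()) (fun _ : Unit => mean X) hl hS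
      (by rw [hcc]; linarith)).trans (MeasureTheory.measure_mono fun S' hS' => ⟨hS'.1, ?_⟩)
    by_contra hneg
    have h1 := cost_le_two_mul_sum_unsettled X (fun _ => ()) (fun _ : Unit => mean X) (S := S')
      (by rw [hcc]; linarith)
    have h2 := hS'.2
    have h3 : (unsettled X (fun _ => ()) (fun _ : Unit => mean X) S).card ≤ 1 :=
      Finset.card_le_univ _
    rw [Finset.card_eq_zero.1 (by omega :
      (unsettled X (fun _ => ()) (fun _ : Unit => mean X) S').card = 0), Finset.sum_empty] at h1
    have h4 : 0 ≤ cost X {mean X} := cost_nonneg _ _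
    linarith

/-- The progress measure of the second analysis.  While the cost is large, every round lowers it by
at least one with high probability: a reduction of the cost by the factor `L` lowers the first
term by two, the round after a crowded state lowers the second one by two, and becoming crowded
is credited by the third one. -/
noncomputable def rank {ι : Type*} [DecidableEq ι] [Fintype ι]
    (X : Fin n → EuclideanSpace ℝ (Fin d)) (a : Fin n → ι)
    (z : ι → EuclideanSpace ℝ (Fin d)) (o L h : ℝ) (S : Finset (Fin n)) : ℝ :=
  open scoped Classical in
  2 * Real.log (cost X (centers X S) / o) / Real.log L + 2 * (unsettled X a z S).card / h
    - (if Crowded X a z L S then 1 else 0)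

theorem rank_decreases {ι : Type*} [DecidableEq ι] [Fintype ι] [Nonempty ι]
    (X : Fin n → EuclideanSpace ℝ (Fin d)) (a : Fin n → ι)
    (z : ι → EuclideanSpace ℝ (Fin d)) {o L : ℝ} (ho : 0 < o) (hL : 2 ^ 20 ≤ L)
    (hcc : ∑ j, centerCost X a z j ≤ 2 * o) {S : Finset (Fin n)} (hS : S.Nonempty)
    (hbad : 160 * o < cost X (centers X S)) {h : ℝ}
    (hh : h = (Fintype.card ι : ℝ) / (4096 * L ^ 3)) :
    ENNReal.ofReal (1 - Real.exp (-h))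
      ≤ (samplingRound X (Fintype.card ι : ℝ) S).toOuterMeasure
        {S' | S ⊆ S' ∧ (160 * o < cost X (centers X S') →
          rank X a z o L h S' + 1 ≤ rank X a z o L h S)} := by
  have hL1 : 1 ≤ L := le_trans (by norm_num) hL
  have hL0 : 0 < L := by linarith
  have hlogL : 0 < Real.log L := Real.log_pos (lt_of_lt_of_le (by norm_num) hL)
  have hk0 : (0 : ℝ) < Fintype.card ι := by exact_mod_cast Fintype.card_pos
  have hh0 : 0 < h := by rw [hh]; positivity
  have hφ : 0 < cost X (centers X S) := by linarith
  have hlog : ∀ S', S ⊆ S' → 160 * o < cost X (centers X S') →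
      2 * Real.log (cost X (centers X S') / o) / Real.log L
        ≤ 2 * Real.log (cost X (centers X S) / o) / Real.log L := by
    intro S' hS' hbad'
    have h1 : Real.log (cost X (centers X S') / o) ≤ Real.log (cost X (centers X S) / o) :=
      Real.log_le_log (div_pos (by linarith) ho)
        ((div_le_div_iff_of_pos_right ho).2 (cost_centers_anti X hS hS'))
    exact (div_le_div_iff_of_pos_right hlogL).2 (by linarith)
  by_cases hc : Crowded X a z L S
  · rw [hh]
    refine (unsettled_card_drop_of_crowded X a z hL1 hS hφ hc).trans
      (MeasureTheory.measure_mono fun S' hS' => ⟨hS'.1, fun hbad' => ?_⟩)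
    have h1 := hlog S' hS'.1 hbad'
    have h2 := hS'.2
    rw [← hh] at h2
    have h3 : 2 * ((unsettled X a z S').card : ℝ) / h + 2
        ≤ 2 * ((unsettled X a z S).card : ℝ) / h := by
      have h4 : 2 * ((unsettled X a z S').card : ℝ) / h + 2
          = 2 * ((unsettled X a z S').card + h) / h := by field_simp
      rw [h4]
      exact (div_le_div_iff_of_pos_right hh0).2 (by linarith)
    rw [rank, rank, if_pos hc, ← hh]
    split_ifs <;> linarith
  · have hε : Real.exp (-((Fintype.card ι : ℝ) / (512 * L))) ≤ Real.exp (-h) := by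
      refine Real.exp_le_exp.2 (neg_le_neg ?_)
      rw [hh]
      refine div_le_div_of_nonneg_left hk0.le (by positivity) ?_
      have : L ≤ L ^ 3 := le_self_pow₀ hL1 (by norm_num)
      linarith
    refine (ENNReal.ofReal_le_ofReal (sub_le_sub_left hε 1)).trans
      ((fast_or_crowded X a z hL hS).trans
        (MeasureTheory.measure_mono fun S' hS' => ⟨hS'.1, fun hbad' => ?_⟩))
    have hu : 2 * ((unsettled X a z S').card : ℝ) / h
        ≤ 2 * ((unsettled X a z S).card : ℝ) / h := by
      refine (div_le_div_iff_of_pos_right hh0).2 (mul_le_mul_of_nonneg_left ?_ (by norm_num))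
      have h1 : unsettled X a z S' ⊆ unsettled X a z S := by
        rw [← Finset.union_eq_right.2 hS'.1]
        exact (unsettled_union_subset X a z hS S').trans (Finset.filter_subset _ _)
      exact_mod_cast Finset.card_le_card h1
    rw [rank, rank, if_neg hc]
    rcases hS'.2 (by linarith) with hfast | hcr
    · have h1 : Real.log (cost X (centers X S') / o) + Real.log L
          ≤ Real.log (cost X (centers X S) / o) := by
        have hpos : 0 < cost X (centers X S') / o := div_pos (by linarith) ho
        rw [← Real.log_mul hpos.ne' hL0.ne']
        refine Real.log_le_log (mul_pos hpos hL0) ?_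
        rw [div_mul_eq_mul_div]
        exact (div_le_div_iff_of_pos_right ho).2 (by linarith)
      have h2 : 2 * Real.log (cost X (centers X S') / o) / Real.log L + 2
          ≤ 2 * Real.log (cost X (centers X S) / o) / Real.log L := by
        have h4 : 2 * Real.log (cost X (centers X S') / o) / Real.log L + 2
            = 2 * (Real.log (cost X (centers X S') / o) + Real.log L) / Real.log L := by
          field_simp
        rw [h4]
        exact (div_le_div_iff_of_pos_right hlogL).2 (by linarith)
      split_ifs <;> linarith
    · rw [if_pos hcr]
      linarith [hlog S' hS'.1 hbad']

/-- Success after a number of rounds that exceeds the maximal rank after the first round. In the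
application, `M = max γ (e ^ e)`. -/
theorem overseeding_of_rounds_gt_rank [NeZero n] (X : Fin n → EuclideanSpace ℝ (Fin d)) {k : ℕ}
    (hk : 1 ≤ k) (ho : 0 < optCost X k) {M L h : ℝ} (hM : cost X {mean X} ≤ M * optCost X k)
    (hL : 2 ^ 20 ≤ L) (hh : h = (k : ℝ) / (4096 * L ^ 3)) {t : ℕ} (ht0 : t ≠ 0)
    (ht : 2 * Real.log (80 * M) / Real.log L + 2 * k / h + 2 < t) :
    ENNReal.ofReal ((1 - Real.exp (-h)) ^ t)
      ≤ (overseeding X (k : ℝ) t).toOuterMeasure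
        {S | S.Nonempty ∧ cost X (centers X S) ≤ 160 * optCost X k} := by
  obtain ⟨a, z, hcc⟩ := exists_clustering hk X ho
  set o := optCost X k
  have hk0 : (0 : ℝ) < k := by exact_mod_cast hk
  have : Nonempty (Fin k) := ⟨⟨0, hk⟩⟩
  have hL1 : 1 ≤ L := le_trans (by norm_num) hL
  have hlogL : 0 < Real.log L := Real.log_pos (lt_of_lt_of_le (by norm_num) hL)
  have hh0 : 0 < h := by rw [hh]; positivity
  set ρ := rank X a z o L h with hρ
  set r := 2 * Real.log (80 * M) / Real.log L + 2 * k / h with hr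
  have hstep := ofReal_pow_le_overseeding X (k : ℝ)
    (fun s => {S | S.Nonempty ∧
      (s = 0 ∨ cost X (centers X S) ≤ 160 * o ∨ ρ S + s ≤ r + 1)})
    (fun i => ⟨Finset.singleton_nonempty i, Or.inl rfl⟩)
    (ε := Real.exp (-h)) (Real.exp_le_one_iff.2 (by linarith))
    (fun s S ⟨hS, hgood⟩ => ?_) t
  · refine hstep.trans (MeasureTheory.measure_mono ?_)
    rintro S ⟨hS, hgood⟩
    refine ⟨hS, ?_⟩
    by_contra hbad
    have h1 := (hgood.resolve_left ht0).resolve_left hbad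
    -- while the cost is large, only the credit for being crowded makes the rank negative
    have h2 : -1 ≤ ρ S := by
      have h3 : 0 ≤ Real.log (cost X (centers X S) / o) := by
        refine Real.log_nonneg ?_
        rw [one_le_div ho]
        linarith
      have h4 : 0 ≤ 2 * Real.log (cost X (centers X S) / o) / Real.log L :=
        div_nonneg (by linarith) hlogL.le
      have h5 : 0 ≤ 2 * ((unsettled X a z S).card : ℝ) / h := by positivity
      rw [hρ, rank]
      split_ifs <;> linarith
    linarith
  · by_cases hbad : cost X (centers X S) ≤ 160 * o
    · refine le_trans ?_ ((one_le_samplingRound_superset X hk0.le S).trans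
        (MeasureTheory.measure_mono fun S' hS' =>
          ⟨hS.mono hS', Or.inr (Or.inl ((cost_centers_anti X hS hS').trans hbad))⟩))
      rw [ENNReal.ofReal_le_one]
      linarith [Real.exp_pos (-h)]
    · rcases Nat.eq_zero_or_pos s with rfl | hs
      · have hε : Real.exp (-((k : ℝ) / 32)) ≤ Real.exp (-h) := by
          refine Real.exp_le_exp.2 (neg_le_neg ?_)
          rw [hh]
          refine div_le_div_of_nonneg_left hk0.le (by norm_num) ?_
          have : 1 ≤ L ^ 3 := one_le_pow₀ hL1
          linarith
        refine (ENNReal.ofReal_le_ofReal (sub_le_sub_left hε 1)).trans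
          ((cost_le_of_first_round X hk0.le hS).trans
            (MeasureTheory.measure_mono fun S' hS' => ⟨hS.mono hS'.1, Or.inr ?_⟩))
        by_cases hbad' : cost X (centers X S') ≤ 160 * o
        · exact Or.inl hbad'
        · refine Or.inr ?_
          have h1 : Real.log (cost X (centers X S') / o) ≤ Real.log (80 * M) := by
            refine Real.log_le_log (div_pos (by linarith) ho) ?_
            rw [div_le_iff₀ ho]
            linarith [hS'.2]
          have h2 : 2 * Real.log (cost X (centers X S') / o) / Real.log L
              ≤ 2 * Real.log (80 * M) / Real.log L :=
            (div_le_div_iff_of_pos_right hlogL).2 (by linarith)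
          have h3 : ((unsettled X a z S').card : ℝ) ≤ k := by
            exact_mod_cast (Finset.card_le_univ _).trans_eq (Fintype.card_fin k)
          have h4 : 2 * ((unsettled X a z S').card : ℝ) / h ≤ 2 * k / h :=
            (div_le_div_iff_of_pos_right hh0).2 (by linarith)
          rw [hρ, rank, hr]
          push_cast
          split_ifs <;> linarith
      · have h1 := (hgood.resolve_left hs.ne').resolve_left hbad
        have h2 := rank_decreases X a z ho hL hcc hS (not_le.1 hbad)
          (h := h) (by rw [Fintype.card_fin]; exact hh)
        rw [Fintype.card_fin] at h2
        refine h2.trans (MeasureTheory.measure_mono fun S' hS' => ⟨hS.mono hS'.1, Or.inr ?_⟩)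
        by_cases hbad' : cost X (centers X S') ≤ 160 * o
        · exact Or.inl hbad'
        · have h3 := hS'.2 (not_le.1 hbad')
          refine Or.inr ?_
          push_cast
          linarith

end KMeansPar

/-! ### The choice of the parameters -/

namespace KMeansPar

/-- This bounds both a power of `log γ` by `log γ / log log γ`, and `√(log γ)` by `k` if
`log γ / log log γ ≤ k`. -/
theorem sqrt_le_div_log {y : ℝ} (hy : Real.exp 1 ≤ y) : √y ≤ y / Real.log y := by
  have he : 2 ≤ Real.exp 1 := by linarith [Real.add_one_le_exp (1 : ℝ)]
  have hy0 : 0 < y := by linarith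
  have hs : 0 < √y := Real.sqrt_pos.2 hy0
  have hlog : 0 < Real.log y := Real.log_pos (by linarith)
  have h1 : Real.log y ≤ √y := by
    have h4 : Real.log (√y) ≤ √y / 2 := by
      have h5 : Real.log (√y / 2) ≤ √y / 2 - 1 := Real.log_le_sub_one_of_pos (by linarith)
      rw [Real.log_div hs.ne' (by norm_num)] at h5
      have h6 : Real.log 2 ≤ 1 := by
        have := Real.log_le_sub_one_of_pos (by norm_num : (0 : ℝ) < 2)
        linarith
      linarith
    have h7 : Real.log y = 2 * Real.log (√y) := by rw [Real.log_sqrt hy0.le]; ring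
    linarith
  rw [le_div_iff₀ hlog]
  nlinarith [Real.mul_self_sqrt hy0.le]

/-- For the scale `L = 2 ^ 20 * y ^ (1 / 12)`, where `y = log γ`, the number of rounds needed is
`O(y / log y)`. -/
theorem rank_bound_le {y : ℝ} (hy : Real.exp 1 ≤ y) {L h k : ℝ}
    (hL : L = 2 ^ 20 * y ^ (1 / 12 : ℝ)) (hk : 0 < k) (hh : h = k / (4096 * L ^ 3)) :
    2 * Real.log (80 * Real.exp y) / Real.log L + 2 * k / h ≤ 2 ^ 74 * (y / Real.log y) := by
  have he : 2 ≤ Real.exp 1 := by linarith [Real.add_one_le_exp (1 : ℝ)]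
  have hy0 : 0 < y := by linarith
  have hy1 : 1 ≤ y := by linarith
  have hlog : 0 < Real.log y := Real.log_pos (by linarith)
  have hp : 0 < y ^ (1 / 12 : ℝ) := Real.rpow_pos_of_pos hy0 _
  have hL0 : 0 < L := by rw [hL]; positivity
  have hr := sqrt_le_div_log hy
  have h1 : Real.log y / 12 ≤ Real.log L := by
    rw [hL, Real.log_mul (by norm_num) hp.ne', Real.log_rpow hy0]
    rw [one_div_mul_eq_div]
    exact le_add_of_nonneg_left (Real.log_nonneg (by norm_num))
  have h2 : Real.log (80 * Real.exp y) ≤ 80 * y := by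
    rw [Real.log_mul (by norm_num) (Real.exp_ne_zero _), Real.log_exp]
    have := Real.log_le_sub_one_of_pos (by norm_num : (0 : ℝ) < 80)
    linarith
  have h3 : 2 * Real.log (80 * Real.exp y) / Real.log L ≤ 1920 * (y / Real.log y) := by
    rw [div_le_iff₀ (by linarith)]
    have h4 : 1920 * (y / Real.log y) * (Real.log y / 12) = 160 * y := by
      field_simp
      ring
    have h5 : 0 ≤ 1920 * (y / Real.log y) := by positivity
    have h6 := mul_le_mul_of_nonneg_left h1 h5
    linarith
  have h7 : L ^ 3 = 2 ^ 60 * y ^ (1 / 4 : ℝ) := by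
    rw [hL, mul_pow, ← Real.rpow_natCast (y ^ (1 / 12 : ℝ)), ← Real.rpow_mul hy0.le]
    norm_num
  have h8 : y ^ (1 / 4 : ℝ) ≤ √y := by
    rw [Real.sqrt_eq_rpow]
    exact Real.rpow_le_rpow_of_exponent_le hy1 (by norm_num)
  have h9 : 2 * k / h = 8192 * L ^ 3 := by
    rw [hh]
    field_simp
    ring
  have h10 : 0 ≤ y / Real.log y := by positivity
  rw [h9, h7]
  linarith

/-- If `y / log y ≤ k`, then the failure probability `exp (-h)` of a single round is exponentially
small in the square root of `k`. -/
theorem sqrt_le_of_div_log_le {y : ℝ} (hy : Real.exp 1 ≤ y) {L h k : ℝ}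
    (hL : L = 2 ^ 20 * y ^ (1 / 12 : ℝ)) (hk : 0 < k) (hh : h = k / (4096 * L ^ 3))
    (hle : y / Real.log y ≤ k) : √k / 2 ^ 72 ≤ h := by
  have he : 2 ≤ Real.exp 1 := by linarith [Real.add_one_le_exp (1 : ℝ)]
  have hy0 : 0 < y := by linarith
  have h7 : L ^ 3 = 2 ^ 60 * y ^ (1 / 4 : ℝ) := by
    rw [hL, mul_pow, ← Real.rpow_natCast (y ^ (1 / 12 : ℝ)), ← Real.rpow_mul hy0.le]
    norm_num
  have h8 : y ^ (1 / 4 : ℝ) ≤ √k := by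
    have h1 : y ^ (1 / 4 : ℝ) = √(√y) := by
      rw [Real.sqrt_eq_rpow, Real.sqrt_eq_rpow, ← Real.rpow_mul hy0.le]
      norm_num
    rw [h1]
    exact Real.sqrt_le_sqrt ((sqrt_le_div_log hy).trans hle)
  have hp : 0 < y ^ (1 / 4 : ℝ) := Real.rpow_pos_of_pos hy0 _
  rw [hh, h7, div_le_div_iff₀ (by norm_num) (by positivity)]
  have h9 := mul_le_mul_of_nonneg_left h8 (Real.sqrt_nonneg k)
  rw [Real.mul_self_sqrt hk.le] at h9
  linarith

/-- The union bound over `O(x)` rounds with failure probability `exp (-Ω(√x))` is affordable. -/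
theorem eventually_mul_exp_le {C δ : ℝ} (hC : 0 < C) (hδ : 0 < δ) :
    ∀ᶠ x : ℝ in Filter.atTop,
      C * x * Real.exp (-(δ * √x)) ≤ Real.exp (-(x ^ (0.1 : ℝ))) := by
  have h1 := (isLittleO_log_rpow_atTop (by norm_num : (0 : ℝ) < 1 / 2)).def
    (by positivity : 0 < δ / 3)
  have h2 := (tendsto_rpow_atTop (by norm_num : (0 : ℝ) < 1 / 2)).eventually_ge_atTop
    (3 * Real.log C / δ)
  have h3 := (tendsto_rpow_atTop (by norm_num : (0 : ℝ) < 2 / 5)).eventually_ge_atTop (3 / δ)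
  filter_upwards [h1, h2, h3, Filter.eventually_ge_atTop 1] with x h1 h2 h3 hx
  have hx0 : 0 < x := by linarith
  have hs : 0 ≤ x ^ (1 / 2 : ℝ) := Real.rpow_nonneg hx0.le _
  rw [Real.norm_of_nonneg (Real.log_nonneg hx), Real.norm_of_nonneg hs] at h1
  rw [div_le_iff₀ hδ] at h2 h3
  have h4 : x ^ (1 / 2 : ℝ) = x ^ (2 / 5 : ℝ) * x ^ (0.1 : ℝ) := by
    rw [← Real.rpow_add hx0]
    norm_num
  have h5 : 3 * x ^ (0.1 : ℝ) ≤ x ^ (1 / 2 : ℝ) * δ := by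
    rw [h4]
    have := mul_le_mul_of_nonneg_right h3 (Real.rpow_nonneg hx0.le (0.1 : ℝ))
    linarith
  rw [← Real.exp_log (mul_pos hC hx0), ← Real.exp_add, Real.log_mul hC.ne' hx0.ne',
    Real.sqrt_eq_rpow]
  refine Real.exp_le_exp.2 ?_
  linarith

/-- The success probability of `t` rounds, by Bernoulli's inequality. -/
theorem one_sub_exp_le_pow {k c ε : ℝ} {t : ℕ} (hc : c ≤ 1) (hk : 1 ≤ k) (hε : ε ≤ 1)
    (h : t * ε ≤ Real.exp (-(k ^ (0.1 : ℝ)))) :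
    1 - Real.exp (-(c * k ^ (0.1 : ℝ))) ≤ (1 - ε) ^ t := by
  have h1 := one_add_mul_le_pow (a := -ε) (by linarith) t
  have h2 : Real.exp (-(k ^ (0.1 : ℝ))) ≤ Real.exp (-(c * k ^ (0.1 : ℝ))) := by
    refine Real.exp_le_exp.2 (neg_le_neg ?_)
    exact mul_le_of_le_one_left (Real.rpow_nonneg (by linarith) _) hc
  rw [← sub_eq_add_neg] at h1
  linarith

theorem cost_mean_le {d n k : ℕ} (X : Fin n → EuclideanSpace ℝ (Fin d))
    (ho : 0 < optCost X k) :
    cost X {mean X} ≤ max (gam X k) (Real.exp (Real.exp 1)) * optCost X k := by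
  rw [← div_le_iff₀ ho]
  exact le_max_left _ _

end KMeansPar

theorem mainTheorem1 :
    ∃ A B c : ℝ, 0 < A ∧ 0 < B ∧ 0 < c ∧
      ∀ (d n k t : ℕ) [NeZero n] (X : Fin n → EuclideanSpace ℝ (Fin d)),
        1 ≤ k → 0 < KMeansPar.optCost X k →
        B * min (k : ℝ) (KMeansPar.logRatio (KMeansPar.gam X k)) ≤ (t : ℝ) →
        ENNReal.ofReal (1 - Real.exp (-(c * (k : ℝ) ^ (0.1 : ℝ)))) ≤
          (KMeansPar.overseeding X (k : ℝ) t).toOuterMeasure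
            {S | KMeansPar.cost X (KMeansPar.centers X S) ≤ A * KMeansPar.optCost X k} := by
  obtain ⟨K₀, hK₀⟩ := Filter.eventually_atTop.1
    ((KMeansPar.eventually_mul_exp_le (C := 2 ^ 75) (δ := 1 / 2 ^ 72)
      (by norm_num) (by norm_num)).and (Filter.eventually_ge_atTop 1))
  have hK1 : 1 ≤ K₀ := (hK₀ K₀ le_rfl).2
  set N := ⌈K₀⌉₊ with hN
  set p : ℝ := (1 - Real.exp (-(1 / 32))) ^ N with hp
  have he32 : Real.exp (-(1 / 32)) < 1 := Real.exp_lt_one_iff.2 (by norm_num)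
  have hp0 : 0 < p := pow_pos (sub_pos.2 he32) _
  have hB : (0 : ℝ) < 2 ^ 75 + N := by positivity
  refine ⟨160, 2 ^ 75 + N, min 1 (p / (N + 1)), by norm_num, hB,
    lt_min one_pos (by positivity), ?_⟩
  intro d n k t _ X hk ho ht
  have hk1 : (1 : ℝ) ≤ k := by exact_mod_cast hk
  have hk0 : (0 : ℝ) < k := by linarith
  set c := min 1 (p / (N + 1)) with hc
  set γ := max (KMeansPar.gam X k) (Real.exp (Real.exp 1)) with hγ
  set y := Real.log γ with hy
  have hγ0 : 0 < γ := lt_of_lt_of_le (Real.exp_pos _) (le_max_right _ _)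
  have hye : Real.exp 1 ≤ y := (Real.le_log_iff_exp_le hγ0).2 (le_max_right _ _)
  have hratio : KMeansPar.logRatio (KMeansPar.gam X k) = y / Real.log y := rfl
  rw [hratio] at ht
  have he : 2 ≤ Real.exp 1 := by linarith [Real.add_one_le_exp (1 : ℝ)]
  have hr1 : 1 ≤ y / Real.log y :=
    (Real.one_le_sqrt.2 (by linarith)).trans (KMeansPar.sqrt_le_div_log hye)
  have hexp1 : ∀ x : ℝ, 0 ≤ x → Real.exp (-x) ≤ 1 := fun x hx => Real.exp_le_one_iff.2 (by linarith)
  -- it suffices to bound the success probability after a smaller number of rounds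
  suffices h : ∃ s ≤ t, ENNReal.ofReal (1 - Real.exp (-(c * (k : ℝ) ^ (0.1 : ℝ))))
      ≤ (KMeansPar.overseeding X (k : ℝ) s).toOuterMeasure {S | S.Nonempty ∧
        KMeansPar.cost X (KMeansPar.centers X S) ≤ 160 * KMeansPar.optCost X k} by
    obtain ⟨s, hst, hs⟩ := h
    exact hs.trans (KMeansPar.overseeding_cost_le_mono X hk0.le _ hst)
  rcases lt_or_ge (k : ℝ) K₀ with hkK | hkK
  · -- few clusters: a positive probability of success is enough
    have hkN : k ≤ N := by
      have := hkK.le.trans (Nat.le_ceil K₀)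
      exact_mod_cast this
    have hkN' : (k : ℝ) ≤ N := by exact_mod_cast hkN
    refine ⟨k, ?_, le_trans (ENNReal.ofReal_le_ofReal ?_)
      (KMeansPar.overseeding_of_rounds_ge_card X hk ho)⟩
    · have h1 := mul_le_mul_of_nonneg_left (le_min hk1 hr1) hB.le
      have h2 : (k : ℝ) ≤ t := by linarith
      exact_mod_cast h2
    · have h1 : p ≤ (1 - Real.exp (-((k : ℝ) / 32))) ^ k := by
        calc p ≤ (1 - Real.exp (-(1 / 32))) ^ k :=
              pow_le_pow_of_le_one (sub_pos.2 he32).le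
                (by linarith [Real.exp_pos (-(1 / 32 : ℝ))]) hkN
          _ ≤ _ := by
              refine pow_le_pow_left₀ (sub_pos.2 he32).le (sub_le_sub_left ?_ 1) k
              exact Real.exp_le_exp.2 (by linarith)
      have h2 : (k : ℝ) ^ (0.1 : ℝ) ≤ N :=
        (Real.rpow_le_self_of_one_le hk1 (by norm_num)).trans hkN'
      have h3 : c * (k : ℝ) ^ (0.1 : ℝ) ≤ p := by
        calc c * (k : ℝ) ^ (0.1 : ℝ) ≤ p / (N + 1) * N :=
              mul_le_mul (min_le_right _ _) h2 (Real.rpow_nonneg hk0.le _) (by positivity)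
          _ ≤ p := by
              rw [div_mul_eq_mul_div, div_le_iff₀ (by positivity)]
              linarith
      have h4 := Real.add_one_le_exp (-(c * (k : ℝ) ^ (0.1 : ℝ)))
      linarith
  · have hev := (hK₀ k hkK).1
    rcases le_total (k : ℝ) (y / Real.log y) with hkr | hkr
    · -- the bound by `k` rounds
      rw [min_eq_left hkr] at ht
      refine ⟨k, ?_, le_trans (ENNReal.ofReal_le_ofReal ?_)
        (KMeansPar.overseeding_of_rounds_ge_card X hk ho)⟩
      · have h2 : (k : ℝ) ≤ t := by
          have : (0 : ℝ) ≤ N * k := by positivity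
          linarith
        exact_mod_cast h2
      · refine KMeansPar.one_sub_exp_le_pow (min_le_left _ _) hk1 (hexp1 _ (by positivity))
          (le_trans ?_ hev)
        refine mul_le_mul (by linarith) (Real.exp_le_exp.2 (neg_le_neg ?_)) (Real.exp_pos _).le
          (by positivity)
        have : √(k : ℝ) ≤ k := Real.sqrt_le_iff.2 ⟨hk0.le, by nlinarith⟩
        linarith
    · -- the bound by `log γ / log log γ` rounds
      rw [min_eq_right hkr] at ht
      set L := 2 ^ 20 * y ^ (1 / 12 : ℝ) with hL
      set h := (k : ℝ) / (4096 * L ^ 3) with hh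
      have hL1 : 2 ^ 20 ≤ L :=
        le_mul_of_one_le_right (by norm_num) (Real.one_le_rpow (by linarith) (by norm_num))
      have hh0 : 0 ≤ h := by
        have : 0 < L := lt_of_lt_of_le (by norm_num) hL1
        positivity
      have hM := KMeansPar.cost_mean_le X ho
      have hbound := KMeansPar.rank_bound_le hye hL hk0 hh
      rw [← hγ, ← Real.exp_log hγ0] at hM
      -- three more than the bound on the rank: the first round, the credit, strict inequality
      set s := ⌈2 ^ 74 * (y / Real.log y)⌉₊ + 3 with hs
      have hs1 : 2 ^ 74 * (y / Real.log y) + 3 ≤ s := by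
        rw [hs]
        push_cast
        linarith [Nat.le_ceil (2 ^ 74 * (y / Real.log y))]
      have hs2 : (s : ℝ) ≤ 2 ^ 75 * (y / Real.log y) := by
        have := Nat.ceil_lt_add_one (by positivity : 0 ≤ 2 ^ 74 * (y / Real.log y))
        rw [hs]
        push_cast
        linarith
      refine ⟨s, ?_, le_trans (ENNReal.ofReal_le_ofReal ?_)
        (KMeansPar.overseeding_of_rounds_gt_rank X hk ho hM hL1 hh (by omega) (by linarith))⟩
      · have h2 : (s : ℝ) ≤ t := by
          have : 0 ≤ N * (y / Real.log y) := by positivity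
          linarith
        exact_mod_cast h2
      · refine KMeansPar.one_sub_exp_le_pow (min_le_left _ _) hk1 (hexp1 _ hh0)
          (le_trans ?_ hev)
        refine mul_le_mul (by linarith) (Real.exp_le_exp.2 (neg_le_neg ?_)) (Real.exp_pos _).le
          (by positivity)
        have := KMeansPar.sqrt_le_of_div_log_le hye hL hk0 hh hkr
        linarith
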